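/- Let $V$ be a finite set. A set function $f\colon 2^V\to\mathbb{R}$ is additive if $f(X)=\sum_{v\in X}f(\{v\})$ for every $X\subseteq V$, and it is XOS if there are an integer $k\ge 1$ and additive set functions $f_1,\dots,f_k\colon 2^V\to\mathbb{R}$ (negative values are allowed) such that $f(X)=\max_{1\le i\le k}f_i(X)$ for every $X\subseteq V$. Two set functions $f,g\colon 2^V\to\mathbb{R}$ are order-equivalent if, for all $X,Y\subseteq V$, $f(X)\le f(Y)$ if and only if $g(X)\le g(Y)$; otherwise they are order-different. For $n\ge 1$ let $N(n)$ be the number of order-different XOS functions on $V=[n]=\{1,\dots,n\}$, that is, the number of order-equivalence classes of XOS functions on $[n]$. Then $N(n)$ is finite and $N(n)=2^{2^{\Theta(n)}}$: there are constants $c,C>0$ such that $$2^{2^{cn}}\le N(n)\le 2^{2^{Cn}}\qquad\text{for all } n\ge 1.$$ -/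

import Mathlib

/-- A set function `f : 2^V → ℝ` is additive if `f X = ∑ v ∈ X, f {v}` for all `X ⊆ V`. -/
def IsAdditive {V : Type*} (f : Finset V → ℝ) : Prop :=
  ∀ X : Finset V, f X = ∑ v ∈ X, f {v}

/-- A set function is XOS if it is the pointwise maximum of finitely many additive set functions
`g 1, …, g k` (which may take negative values). Since the maximum has to be attained at some index,
`k = 0` is impossible. -/
def IsXOS {V : Type*} (f : Finset V → ℝ) : Prop :=
  ∃ (k : ℕ) (g : Fin k → Finset V → ℝ),
    (∀ i, IsAdditive (g i)) ∧ ∀ X : Finset V, IsGreatest (Set.range fun i => g i X) (f X)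

/-- Two set functions are order-equivalent if they compare any two sets in the same way. They are
order-different if they are not order-equivalent. -/
def OrderEquivalent {V : Type*} (f g : Finset V → ℝ) : Prop :=
  ∀ X Y : Finset V, f X ≤ f Y ↔ g X ≤ g Y

/-- Order-equivalence as an equivalence relation on the XOS functions on `V`. -/
def xosSetoid (V : Type*) : Setoid {f : Finset V → ℝ // IsXOS f} where
  r f g := OrderEquivalent f.1 g.1
  iseqv :=
    { refl := fun _ _ _ => Iff.rfl
      symm := fun h X Y => (h X Y).symm
      trans := fun h₁ h₂ X Y => (h₁ X Y).trans (h₂ X Y) }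

/-- The number of order-different XOS functions on an `n`-element ground set: the number of
order-equivalence classes of XOS functions. -/
noncomputable def numOrderDifferentXOS (n : ℕ) : ℕ :=
  Nat.card (Quotient (xosSetoid (Fin n)))

/-! Upper bound: a class is determined by its comparison relation, a subset of `2^V × 2^V`, so there
are at most `2^(4^n)` classes. Lower bound: fix `k ≥ 1` and give each family `F` of `k`-sets the
maximum of `0` and the weights peaked at the members of `F`. On `k`-sets it is positive exactly on
`F`, and positivity is a comparison with `∅`, so the order recovers `F`. With `k` about `n/2` this
gives `2^(n.choose k)` classes. -/

/-- The pointwise maximum of the additive functions with weight vectors in `s`. -/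
noncomputable def maxWeight {V : Type*} (s : Finset (V → ℝ)) (hs : s.Nonempty) (X : Finset V) : ℝ :=
  s.sup' hs fun w => ∑ v ∈ X, w v

theorem isXOS_maxWeight {V : Type*} (s : Finset (V → ℝ)) (hs : s.Nonempty) :
    IsXOS (maxWeight s hs) := by
  refine ⟨s.card, fun i X => ∑ v ∈ X, (s.equivFin.symm i : V → ℝ) v, fun i X => by simp,
    fun X => ⟨?_, ?_⟩⟩
  · obtain ⟨w, hw, h⟩ := Finset.exists_mem_eq_sup' hs fun w : V → ℝ => ∑ v ∈ X, w v
    exact ⟨s.equivFin ⟨w, hw⟩, by simp [maxWeight, h]⟩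
  · rintro _ ⟨i, rfl⟩
    exact Finset.le_sup' (fun w : V → ℝ => ∑ v ∈ X, w v) (s.equivFin.symm i).2

theorem maxWeight_empty {V : Type*} (s : Finset (V → ℝ)) (hs : s.Nonempty) :
    maxWeight s hs ∅ = 0 := by
  simp [maxWeight]

/-- Weight `1` inside `S` and a large negative weight outside `S`. -/
noncomputable def peakWeight {V : Type*} [Fintype V] [DecidableEq V] (S : Finset V) (v : V) : ℝ :=
  if v ∈ S then 1 else -(Fintype.card V : ℝ)

/-- Among the nonempty sets of the size of `S`, only `S` has positive weight. -/
theorem sum_peakWeight_pos_iff {V : Type*} [Fintype V] [DecidableEq V] {S X : Finset V}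
    (hcard : X.card = S.card) (hS : 0 < S.card) : 0 < ∑ v ∈ X, peakWeight S v ↔ X = S := by
  constructor
  · intro hpos
    by_contra hne
    have hsub : ¬ X ⊆ S := fun h => hne (Finset.eq_of_subset_of_card_le h hcard.ge)
    obtain ⟨v, hv, hvS⟩ := Finset.not_subset.1 hsub
    have hout : (1 : ℝ) ≤ (X.filter fun v => v ∉ S).card := by
      exact_mod_cast Finset.card_pos.2 ⟨v, by simp [hv, hvS]⟩
    have hin : ((X.filter fun v => v ∈ S).card : ℝ) ≤ Fintype.card V := by
      exact_mod_cast Finset.card_le_univ _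
    have hsum : ∑ v ∈ X, peakWeight S v = (X.filter fun v => v ∈ S).card -
        (X.filter fun v => v ∉ S).card * (Fintype.card V : ℝ) := by
      simp only [peakWeight, Finset.sum_ite, Finset.sum_const, nsmul_eq_mul]
      ring
    have hV : (0 : ℝ) ≤ Fintype.card V := Nat.cast_nonneg _
    -- The sum is at most `|V| - 1 * |V| = 0`: one element outside `S` cancels every gain inside.
    nlinarith
  · rintro rfl
    have h : ∑ v ∈ X, peakWeight X v = X.card := by
      rw [Finset.sum_congr rfl fun v hv => show peakWeight X v = 1 from if_pos hv]
      simp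
    rw [h]
    exact_mod_cast hS

open Classical in
/-- The weight vectors attached to a family of sets; `none` gives a negative additive function. -/
noncomputable def familyWeights {V : Type*} [Fintype V] :
    Option (Finset (Finset V)) → Finset (V → ℝ)
  | none => {fun _ => -1}
  | some F => insert 0 (F.image peakWeight)

theorem familyWeights_nonempty {V : Type*} [Fintype V] (o : Option (Finset (Finset V))) :
    (familyWeights o).Nonempty := by
  cases o <;> simp [familyWeights]

/-- The XOS function attached to a family of sets. -/
noncomputable def familyXOS {V : Type*} [Fintype V] (o : Option (Finset (Finset V))) :
    {f : Finset V → ℝ // IsXOS f} :=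
  ⟨maxWeight _ (familyWeights_nonempty o), isXOS_maxWeight _ (familyWeights_nonempty o)⟩

theorem familyXOS_empty {V : Type*} [Fintype V] (o : Option (Finset (Finset V))) :
    (familyXOS o).1 ∅ = 0 :=
  maxWeight_empty _ (familyWeights_nonempty o)

theorem familyXOS_none {V : Type*} [Fintype V] (X : Finset V) :
    (familyXOS none).1 X = -(X.card : ℝ) := by
  simp [familyXOS, maxWeight, familyWeights]

theorem familyXOS_some_nonneg {V : Type*} [Fintype V] (F : Finset (Finset V)) (X : Finset V) :
    0 ≤ (familyXOS (some F)).1 X := by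
  have h : (0 : V → ℝ) ∈ familyWeights (some F) := by simp [familyWeights]
  exact (Finset.le_sup'_iff (familyWeights_nonempty (some F))).2 ⟨0, h, by simp⟩

theorem familyXOS_some_pos_iff {V : Type*} [Fintype V] {k : ℕ} (hk : 0 < k)
    {F : Finset (Finset V)} (hF : ∀ S ∈ F, S.card = k) {X : Finset V} (hX : X.card = k) :
    0 < (familyXOS (some F)).1 X ↔ X ∈ F := by
  classical
  refine (Finset.lt_sup'_iff (familyWeights_nonempty (some F))).trans ?_
  simp only [familyWeights, Finset.mem_insert, Finset.mem_image]
  constructor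
  · rintro ⟨w, rfl | ⟨S, hS, rfl⟩, hpos⟩
    · simp at hpos
    · have hcard := hF S hS
      rwa [(sum_peakWeight_pos_iff (hX.trans hcard.symm) (hcard ▸ hk)).1
        (by convert hpos)]
  · intro h
    refine ⟨_, Or.inr ⟨X, h, rfl⟩, ?_⟩
    convert (sum_peakWeight_pos_iff (S := X) rfl (hX ▸ hk)).2 rfl

/-- Families of `k`-sets give order-different XOS functions. -/
theorem familyXOS_injective {V : Type*} [Fintype V] {k : ℕ} (hk : 0 < k)
    (hkV : k ≤ Fintype.card V) :
    Function.Injective fun o : Option ((Finset.univ : Finset V).powersetCard k).powerset =>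
      (Quotient.mk (xosSetoid V) (familyXOS (o.map Subtype.val))) := by
  intro o o' h
  have hequiv : OrderEquivalent (familyXOS (o.map Subtype.val)).1
      (familyXOS (o'.map Subtype.val)).1 := Quotient.exact h
  obtain ⟨Y, -, hY⟩ := Finset.exists_subset_card_eq (s := (Finset.univ : Finset V)) hkV
  have hYpos : (0 : ℝ) < Y.card := by exact_mod_cast hY ▸ hk
  have hcard (F : ((Finset.univ : Finset V).powersetCard k).powerset) :
      ∀ S ∈ F.1, S.card = k := fun S hS =>
    (Finset.mem_powersetCard.1 (Finset.mem_powerset.1 F.2 hS)).2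
  match o, o' with
  | none, none => rfl
  | none, some F =>
    -- The nonempty set `Y` lies strictly below `∅` for `none`, but never for `some F`.
    have := (hequiv ∅ Y).2 (by
      rw [familyXOS_empty]
      exact familyXOS_some_nonneg _ _)
    rw [familyXOS_empty, Option.map_none, familyXOS_none] at this
    linarith
  | some F, none =>
    have := (hequiv ∅ Y).1 (by
      rw [familyXOS_empty]
      exact familyXOS_some_nonneg _ _)
    rw [familyXOS_empty, Option.map_none, familyXOS_none] at this
    linarith
  | some F, some G =>
    congr 1
    ext X
    by_cases hX : X.card = k
    · rw [← familyXOS_some_pos_iff hk (hcard F) hX, ← familyXOS_some_pos_iff hk (hcard G) hX]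
      have := hequiv X ∅
      simp only [familyXOS_empty, Option.map_some] at this
      rw [← not_le, ← not_le, this]
    · exact ⟨fun h => absurd (hcard F X h) hX, fun h => absurd (hcard G X h) hX⟩

/-- An order-equivalence class is determined by the comparisons it makes. -/
theorem exists_injective_quotient_xosSetoid (V : Type*) :
    ∃ φ : Quotient (xosSetoid V) → Set (Finset V × Finset V), Function.Injective φ := by
  refine ⟨Quotient.lift (fun f => {p | f.1 p.1 ≤ f.1 p.2}) fun f g h => ?_, ?_⟩
  · ext p
    exact h p.1 p.2
  · rintro ⟨f⟩ ⟨g⟩ h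
    exact Quotient.sound fun X Y => Set.ext_iff.1 h (X, Y)

theorem finite_quotient_xosSetoid (V : Type*) [Finite V] : Finite (Quotient (xosSetoid V)) :=
  let ⟨_, hφ⟩ := exists_injective_quotient_xosSetoid V
  Finite.of_injective _ hφ

theorem numOrderDifferentXOS_le (n : ℕ) : numOrderDifferentXOS n ≤ 2 ^ 2 ^ (2 * n) := by
  obtain ⟨φ, hφ⟩ := exists_injective_quotient_xosSetoid (Fin n)
  refine (Nat.card_le_card_of_injective φ hφ).trans_eq ?_
  rw [Nat.card_eq_fintype_card]
  simp [two_mul, pow_add]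

theorem le_numOrderDifferentXOS {n k : ℕ} (hk : 0 < k) (hkn : k ≤ n) :
    2 ^ n.choose k + 1 ≤ numOrderDifferentXOS n := by
  have := finite_quotient_xosSetoid (Fin n)
  refine le_of_eq_of_le ?_ (Nat.card_le_card_of_injective _
    (familyXOS_injective (V := Fin n) hk (by simpa using hkn)))
  rw [Finite.card_option, Nat.card_eq_fintype_card, Fintype.card_coe]
  simp

/-- Applying Pascal's rule twice shows that the coefficient at least doubles from `n` to `n + 2`. -/
theorem two_pow_le_choose_middle : ∀ n : ℕ, 2 ^ (n / 2) ≤ n.choose ((n + 1) / 2)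
  | 0 => by simp
  | 1 => by simp
  | n + 2 => by
    have ih := two_pow_le_choose_middle n
    rw [show (n + 2) / 2 = n / 2 + 1 by omega, show (n + 2 + 1) / 2 = (n + 1) / 2 + 1 by omega,
      Nat.choose_succ_succ, pow_succ, Nat.choose_succ_succ n]
    have : n.choose ((n + 1) / 2) ≤ (n + 1).choose ((n + 1) / 2) :=
      Nat.choose_le_choose _ (Nat.le_succ n)
    omega

theorem two_rpow_two_rpow_quarter_le : (2 : ℝ) ^ ((2 : ℝ) ^ (1 / 4 : ℝ)) ≤ 3 := by
  have h₁ : (2 : ℝ) ^ (1 / 4 : ℝ) ≤ 3 / 2 := by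
    refine le_of_pow_le_pow_left₀ (n := 4) (by norm_num) (by norm_num) ?_
    rw [← Real.rpow_mul_natCast (by norm_num)]
    norm_num
  refine (Real.rpow_le_rpow_of_exponent_le (by norm_num) h₁).trans ?_
  refine le_of_pow_le_pow_left₀ (n := 2) (by norm_num) (by norm_num) ?_
  rw [← Real.rpow_mul_natCast (by norm_num), show (3 / 2 : ℝ) * (2 : ℕ) = (3 : ℕ) by norm_num,
    Real.rpow_natCast]
  norm_num

theorem mainTheorem8 :
    ∃ c C : ℝ, 0 < c ∧ 0 < C ∧ ∀ n : ℕ, 1 ≤ n →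
      Finite (Quotient (xosSetoid (Fin n))) ∧
      (2 : ℝ) ^ ((2 : ℝ) ^ (c * (n : ℝ))) ≤ (numOrderDifferentXOS n : ℝ) ∧
      (numOrderDifferentXOS n : ℝ) ≤ (2 : ℝ) ^ ((2 : ℝ) ^ (C * (n : ℝ))) := by
  refine ⟨1 / 4, 2, by norm_num, by norm_num, fun n hn => ⟨finite_quotient_xosSetoid _, ?_, ?_⟩⟩
  · have hlow : (2 : ℝ) ^ n.choose ((n + 1) / 2) + 1 ≤ numOrderDifferentXOS n := by
      exact_mod_cast le_numOrderDifferentXOS (n := n) (k := (n + 1) / 2) (by omega) (by omega)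
    refine le_trans ?_ hlow
    -- For `n = 1` families give only `2 < 2^(2^c)` classes; the extra class from `none` raises this
    -- to `3`.
    obtain rfl | hn2 := hn.eq_or_lt
    · have := two_rpow_two_rpow_quarter_le
      norm_num at this ⊢
      exact this
    -- The constant `1/4` absorbs the rounding in `n / 2`; the worst case is `n = 3`.
    · have hexp : (1 / 4 : ℝ) * n ≤ (n / 2 : ℕ) := by
        have : (n : ℝ) ≤ 4 * (n / 2 : ℕ) := by exact_mod_cast (by omega : n ≤ 4 * (n / 2))
        linarith
      have hpow : (2 : ℝ) ^ ((1 / 4 : ℝ) * n) ≤ n.choose ((n + 1) / 2) := by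
        refine (Real.rpow_le_rpow_of_exponent_le (by norm_num) hexp).trans ?_
        rw [Real.rpow_natCast]
        exact_mod_cast two_pow_le_choose_middle n
      refine (Real.rpow_le_rpow_of_exponent_le (by norm_num) hpow).trans ?_
      rw [Real.rpow_natCast]
      linarith
  · rw [show (2 : ℝ) * n = (2 * n : ℕ) by push_cast; rfl, Real.rpow_natCast,
      show (2 : ℝ) ^ (2 * n) = (2 ^ (2 * n) : ℕ) by push_cast; rfl, Real.rpow_natCast]
    exact_mod_cast numOrderDifferentXOS_le n
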